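/- Let $d,n$ be positive integers with $2d\mid n$. A family $\mathcal F\subseteq\binom{[n]}{n/d}$ is called $d$-Galvin if for every $A\subseteq[n]$ with $|A|=n/2$ there are sets $S_1,\dots,S_d\in\mathcal F$ that form a partition of $[n]$ and satisfy $|S_i\cap A|=\frac{n}{2d}$ for every $i$. Theorem. There exist absolute constants $c_1,c_2\in\mathbb Z$ such that for all positive integers $d,n$ with $2d\mid n$, writing $f=n^2d^9$, there is a $d$-Galvin family $\mathcal F\subseteq\binom{[n]}{n/d}$ whose size satisfies $$\min\Big\{f\,(\ln f)^{c_1},\ \tbinom{n}{n/d}\Big\}\ \le\ |\mathcal F|\ \le\ f\,(\ln f)^{c_2}.$$ That is, there is a $d$-Galvin family of size $\tilde\Theta(n^2d^9)$, where the lower bound on the size is capped at $\binom{n}{n/d}$, the number of all $(n/d)$-element subsets of $[n]$. -/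

import Mathlib

/-- `S` is balanced on `A`: `|S ∩ A| = |S| / 2`. -/
def BalancedOn {n : ℕ} (S A : Finset (Fin n)) : Prop :=
  2 * (S ∩ A).card = S.card

/-- `A` is handled by `F` (with `d` parts): some `S₁, …, S_d ∈ F` partition the ground set
and are all balanced on `A`. -/
def IsHandledBy {n : ℕ} (d : ℕ) (F : Finset (Finset (Fin n))) (A : Finset (Fin n)) : Prop :=
  ∃ S : Fin d → Finset (Fin n),
    (∀ i, S i ∈ F) ∧
    (∀ i j, i ≠ j → Disjoint (S i) (S j)) ∧
    Finset.univ.biUnion S = Finset.univ ∧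
    ∀ i, BalancedOn (S i) A

/-- `F` is a `d`-Galvin family on the `n`-element set `Fin n` (used for `2 * d ∣ n`, so that
both divisions are exact). -/
def IsGalvinFamily {n : ℕ} (d : ℕ) (F : Finset (Finset (Fin n))) : Prop :=
  F ⊆ Finset.powersetCard (n / d) Finset.univ ∧
  ∀ A ∈ Finset.powersetCard (n / 2) (Finset.univ : Finset (Fin n)), IsHandledBy d F A

/-! Write `n = 2 * d * h` and cut the ground set into `2d` blocks of size `h`. Call `A` typical if,
for every block `C a`, the coefficient `h.choose #(C a ∩ A)` is not too small. By Chebyshev, all but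
a small fraction of halving sets are typical.

A typical `A` is balanced by chaining (`exists_balanced_partition`): carry a piece of size `h`,
choose two fresh blocks whose imbalances keep the running sum bounded, complete the piece to a
balanced set with half of their union, and carry the other half. Only typical splits of pairs of
blocks are needed. A random half of a pair realises a given typical split with probability at least
of order `1 / (d ^ 3 * √h)` (`hitProb_mul_choose_le`), so by greedy covering about `K ≈ d ^ 3 * √h *
log` halves per pair serve most `A`.

Taking all unions of two among the `O(d ^ 2 * K)` pieces handles half of all halving sets
(`exists_family_handling_half`). Greedily chosen permuted copies, at most `n + 1` of them, handle
the rest (`exists_galvin_of_half`). The size is of order `n * (d ^ 2 * K) ^ 2 ≈ n * d ^ 10 * h * log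
^ 2 ≈ n ^ 2 * d ^ 9 * log ^ 2`. The lower bound is obtained by padding, since supersets of Galvin
families within the `(n / d)`-sets are Galvin. -/

open Finset

/-! ### Greedy covering -/

/-- Greedy covering: if every point of `s` is hit by at least a `q`-fraction of `Ω`, then some `K`
elements of `Ω` miss at most a `(1 - q) ^ K`-fraction of `s`. -/
theorem exists_greedy_cover {α β : Type*} [DecidableEq β] (s : Finset α) (Ω : Finset β)
    (R : α → β → Prop) [∀ x y, Decidable (R x y)] {q : ℝ} (hq1 : q ≤ 1) (hΩ : Ω.Nonempty)
    (hq : ∀ x ∈ s, q * (#Ω : ℝ) ≤ #{y ∈ Ω | R x y}) (K : ℕ) :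
    ∃ G ⊆ Ω, #G ≤ K ∧ (#{x ∈ s | ∀ y ∈ G, ¬ R x y} : ℝ) ≤ (1 - q) ^ K * #s := by
  induction K with
  | zero => exact ⟨∅, by simp, by simp, by simp⟩
  | succ K ih =>
    obtain ⟨G, hGΩ, hGK, hG⟩ := ih
    set t := {x ∈ s | ∀ y ∈ G, ¬ R x y} with ht
    -- Double counting on the still uncovered `t`: the average `y` hits a `q`-fraction of `t`, so
    -- some `y` does.
    have hdc : ∑ y ∈ Ω, (#{x ∈ t | R x y} : ℝ) = ∑ x ∈ t, (#{y ∈ Ω | R x y} : ℝ) := by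
      exact_mod_cast (sum_card_bipartiteAbove_eq_sum_card_bipartiteBelow R (s := t) (t := Ω)).symm
    have hlow : ∑ _y ∈ Ω, q * (#t : ℝ) ≤ ∑ y ∈ Ω, (#{x ∈ t | R x y} : ℝ) := by
      rw [hdc, sum_const, nsmul_eq_mul]
      calc (#Ω : ℝ) * (q * #t) = ∑ _x ∈ t, q * (#Ω : ℝ) := by
            rw [sum_const, nsmul_eq_mul]; ring
        _ ≤ _ := sum_le_sum fun x hx => hq x (mem_filter.1 hx).1
    obtain ⟨y, hy, hyt⟩ := exists_le_of_sum_le hΩ hlow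
    refine ⟨insert y G, insert_subset hy hGΩ, (card_insert_le _ _).trans (by omega), ?_⟩
    have heq : {x ∈ s | ∀ z ∈ insert y G, ¬ R x z} = {x ∈ t | ¬ R x y} := by
      ext x; simp only [ht, mem_filter, mem_insert, forall_eq_or_imp]; tauto
    have hsplit : (#{x ∈ t | R x y} : ℝ) + #{x ∈ t | ¬ R x y} = #t := by
      exact_mod_cast card_filter_add_card_filter_not (s := t) (fun x => R x y)
    rw [heq, pow_succ]
    calc (#{x ∈ t | ¬ R x y} : ℝ) ≤ (1 - q) * #t := by linarith
      _ ≤ (1 - q) * ((1 - q) ^ K * #s) := mul_le_mul_of_nonneg_left hG (by linarith)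
      _ = _ := by ring

/-! ### Binomial identities and estimates -/

/-- Subsets of `U` of size `r` that meet `B` in exactly `w` points. -/
theorem card_filter_card_inter_eq {α : Type*} [DecidableEq α] (U B : Finset α) {r w : ℕ}
    (hw : w ≤ r) :
    #{W ∈ powersetCard r U | #(W ∩ B) = w} =
      (#(U ∩ B)).choose w * (#(U \ B)).choose (r - w) := by
  rw [← card_powersetCard, ← card_powersetCard, ← card_product]
  symm
  have key : ∀ {X Y : Finset α}, X ⊆ U ∩ B → Y ⊆ U \ B →
      (X ∪ Y) ∩ B = X ∧ (X ∪ Y) \ B = Y := by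
    intro X Y hX hY
    constructor <;> ext z <;> have h1 := @hX z <;> have h2 := @hY z <;>
      simp only [mem_inter, mem_union, mem_sdiff] at * <;> tauto
  refine card_bij' (fun p _ => p.1 ∪ p.2) (fun W _ => (W ∩ B, W \ B)) ?_ ?_ ?_ ?_
  · rintro ⟨X, Y⟩ h
    simp only [mem_product, mem_powersetCard, mem_filter] at h ⊢
    obtain ⟨⟨hX, hXc⟩, hY, hYc⟩ := h
    refine ⟨⟨union_subset (hX.trans inter_subset_left) (hY.trans sdiff_subset), ?_⟩, ?_⟩
    · have h := card_inter_add_card_sdiff (X ∪ Y) B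
      rw [(key hX hY).1, (key hX hY).2] at h
      omega
    · rw [(key hX hY).1, hXc]
  · intro W h
    simp only [mem_product, mem_powersetCard, mem_filter] at h ⊢
    obtain ⟨⟨hWU, hWc⟩, hw'⟩ := h
    refine ⟨⟨inter_subset_inter_right hWU, hw'⟩, sdiff_subset_sdiff hWU le_rfl, ?_⟩
    have h := card_inter_add_card_sdiff W B
    omega
  · rintro ⟨X, Y⟩ h
    simp only [mem_product, mem_powersetCard] at h
    simp [key h.1.1 h.2.1]
  · intro W _
    ext z; simp only [mem_union, mem_inter, mem_sdiff]; tauto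

theorem choose_mono_of_le_half {h k w : ℕ} (hkw : k ≤ w) (hw : 2 * w ≤ h) :
    h.choose k ≤ h.choose w := by
  induction w, hkw using Nat.le_induction with
  | base => rfl
  | succ w _ ih =>
    exact (ih (by omega)).trans (Nat.choose_le_succ_of_lt_half_left (by omega))

/-- Binomial coefficients decrease away from the middle. -/
theorem choose_le_choose_of_abs_le {h k w : ℕ} (hk : k ≤ h) (hw : w ≤ h)
    (hkw : |2 * (w : ℤ) - h| ≤ |2 * (k : ℤ) - h|) : h.choose k ≤ h.choose w := by
  have main : ∀ {k w : ℕ}, 2 * k ≤ h → 2 * w ≤ h → |2 * (w : ℤ) - h| ≤ |2 * (k : ℤ) - h| →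
      h.choose k ≤ h.choose w := by
    intro k w hk hw hkw
    rw [abs_of_nonpos (by omega), abs_of_nonpos (by omega)] at hkw
    exact choose_mono_of_le_half (by omega) hw
  have flip : ∀ {x : ℕ}, x ≤ h → |2 * ((h - x : ℕ) : ℤ) - h| = |2 * (x : ℤ) - h| := by
    intro x hx
    rw [← abs_neg]; congr 1; omega
  rcases le_total (2 * k) h with h1 | h1 <;> rcases le_total (2 * w) h with h2 | h2
  · exact main h1 h2 hkw
  · rw [← Nat.choose_symm hw]; exact main h1 (by omega) (by rwa [flip hw])
  · rw [← Nat.choose_symm hk]; exact main (by omega) h2 (by rwa [flip hk])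
  · rw [← Nat.choose_symm hk, ← Nat.choose_symm hw]
    exact main (by omega) (by omega) (by rwa [flip hk, flip hw])

/-- The two ways of counting `2 × 2` contingency tables. -/
theorem choose_mul_choose_mul_choose (a b c e : ℕ) :
    (a + b).choose a * (c + e).choose c * (a + c + (b + e)).choose (a + b) =
      (a + c).choose a * (b + e).choose b * (a + c + (b + e)).choose (a + c) := by
  have h : ∀ x y : ℕ, (x + y).choose x * x.factorial * y.factorial = (x + y).factorial := by
    intro x y
    have := Nat.choose_mul_factorial_mul_factorial (Nat.le_add_right x y)
    rwa [Nat.add_sub_cancel_left] at this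
  have h1 := h a b
  have h2 := h c e
  have h3 := h (a + b) (c + e)
  have h4 := h a c
  have h5 := h b e
  have h6 := h (a + c) (b + e)
  rw [show a + b + (c + e) = a + c + (b + e) by ring] at h3
  have hpos : 0 < a.factorial * b.factorial * c.factorial * e.factorial := by positivity
  apply Nat.eq_of_mul_eq_mul_right hpos
  calc _ = (a + c + (b + e)).choose (a + b) * ((a + b).choose a * a.factorial * b.factorial) *
        ((c + e).choose c * c.factorial * e.factorial) := by ring
    _ = (a + c + (b + e)).choose (a + c) * ((a + c).choose a * a.factorial * c.factorial) *
        ((b + e).choose b * b.factorial * e.factorial) := by rw [h1, h2, h3, h4, h5, h6]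
    _ = _ := by ring

/-- Induction on the ratio `2 * (2 * k + 1) / (k + 1)` of consecutive central coefficients; the step
reduces to `(2 * k + 1) * (2 * k + 3) ≤ (2 * k + 2) ^ 2`. -/
theorem sq_centralBinom_mul_le (k : ℕ) : k.centralBinom ^ 2 * (2 * k + 1) ≤ 16 ^ k := by
  induction k with
  | zero => simp
  | succ k ih =>
    have hs := Nat.succ_mul_centralBinom_succ k
    have : (k + 1) ^ 2 * ((k + 1).centralBinom ^ 2 * (2 * (k + 1) + 1)) ≤
        (k + 1) ^ 2 * 16 ^ (k + 1) := by
      calc _ = ((k + 1) * (k + 1).centralBinom) ^ 2 * (2 * k + 3) := by ring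
        _ = (k.centralBinom ^ 2 * (2 * k + 1)) * (4 * ((2 * k + 1) * (2 * k + 3))) := by
          rw [hs]; ring
        _ ≤ 16 ^ k * (4 * ((2 * k + 1) * (2 * k + 3))) := Nat.mul_le_mul_right _ ih
        _ ≤ 16 ^ k * (16 * (k + 1) ^ 2) := by
          apply Nat.mul_le_mul_left; nlinarith
        _ = _ := by ring
    exact Nat.le_of_mul_le_mul_left this (by positivity)

/-- Companion bound with the same ratio; the step now reduces to `4 * k * (k + 1) ≤ (2 * k + 1) ^
2`. -/
theorem le_sq_centralBinom_mul {k : ℕ} (hk : 0 < k) : 16 ^ k ≤ k.centralBinom ^ 2 * (4 * k) := by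
  induction k, hk using Nat.le_induction with
  | base => simp [Nat.centralBinom]
  | succ k hk ih =>
    have hs := Nat.succ_mul_centralBinom_succ k
    have : (k * (k + 1) ^ 2) * 16 ^ (k + 1) ≤
        (k * (k + 1) ^ 2) * ((k + 1).centralBinom ^ 2 * (4 * (k + 1))) := by
      calc _ = 16 ^ k * (16 * k * (k + 1) ^ 2) := by ring
        _ ≤ (k.centralBinom ^ 2 * (4 * k)) * (16 * k * (k + 1) ^ 2) := Nat.mul_le_mul_right _ ih
        _ = (k.centralBinom ^ 2 * (4 * k * (k + 1))) * (16 * (k * (k + 1))) := by ring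
        _ ≤ (k.centralBinom ^ 2 * (4 * k * (k + 1))) * (4 * (2 * k + 1) ^ 2) := by
          apply Nat.mul_le_mul_left; nlinarith
        _ = (2 * (2 * k + 1) * k.centralBinom) ^ 2 * (4 * k * (k + 1)) := by ring
        _ = ((k + 1) * (k + 1).centralBinom) ^ 2 * (4 * k * (k + 1)) := by rw [hs]
        _ = _ := by ring
    exact Nat.le_of_mul_le_mul_left this (by positivity)

theorem sq_choose_mul_le (N r : ℕ) : N.choose r ^ 2 * (N + 1) ≤ 4 ^ N := by
  have hmid : N.choose r ≤ N.choose (N / 2) := Nat.choose_le_middle r N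
  refine (Nat.mul_le_mul_right _ (Nat.pow_le_pow_left hmid 2)).trans ?_
  rcases Nat.even_or_odd' N with ⟨k, rfl | rfl⟩
  · have := sq_centralBinom_mul_le k
    rw [Nat.centralBinom] at this
    rw [Nat.mul_div_cancel_left k two_pos, pow_mul]
    exact this
  · have h := sq_centralBinom_mul_le (k + 1)
    have h2 : (k + 1).centralBinom = 2 * (2 * k + 1).choose k := by
      rw [Nat.centralBinom, show 2 * (k + 1) = 2 * k + 1 + 1 by ring, Nat.choose_succ_succ,
        Nat.choose_symm_half]; ring
    rw [h2] at h
    rw [show (2 * k + 1) / 2 = k by omega, pow_succ 4, pow_mul 4]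
    norm_num at h ⊢
    rw [pow_succ 16] at h
    nlinarith

/-- Removing `h ≤ n / 2` points from an `n`-set divides the middle binomial coefficient by at least
`2 ^ (h - 1)`. -/
theorem two_pow_mul_choose_le {n h : ℕ} (hn : Even n) (hn0 : 0 < n) (hh : 2 * h ≤ n) (r : ℕ) :
    2 ^ h * (n - h).choose r ≤ 2 * n.choose (n / 2) := by
  obtain ⟨k, rfl⟩ := hn
  rw [← two_mul] at *
  have h1 := sq_choose_mul_le (2 * k - h) r
  have h2 := le_sq_centralBinom_mul (k := k) (by omega)
  rw [Nat.mul_div_cancel_left k two_pos]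
  rw [Nat.centralBinom] at h2
  rw [← Nat.pow_le_pow_iff_left two_ne_zero]
  have hpos : 0 < k := by omega
  apply Nat.le_of_mul_le_mul_right _ hpos
  -- Since `2 * h ≤ n`, `k ≤ 2 * k - h + 1`, so the square-root factors of the two estimates cancel
  -- up to the constant 2.
  calc (2 ^ h * (2 * k - h).choose r) ^ 2 * k
      ≤ 4 ^ h * ((2 * k - h).choose r ^ 2 * (2 * k - h + 1)) := by
        rw [mul_pow, ← pow_mul, mul_comm h 2, pow_mul]
        norm_num
        rw [mul_assoc]
        apply Nat.mul_le_mul_left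
        apply Nat.mul_le_mul_left
        omega
    _ ≤ 4 ^ h * 4 ^ (2 * k - h) := Nat.mul_le_mul_left _ h1
    _ = 16 ^ k := by
        rw [← pow_add, show h + (2 * k - h) = 2 * k by omega, pow_mul]; norm_num
    _ ≤ _ := h2
    _ = _ := by ring

/-- Variance of the symmetric binomial law, read off from the Bernstein polynomials at `1 / 2`. -/
theorem sum_choose_mul_sq (h : ℕ) :
    ∑ k ∈ range (h + 1), (h.choose k : ℝ) * (2 * k - h) ^ 2 = (h : ℝ) * 2 ^ h := by
  have hv := congrArg (Polynomial.eval (1 / 2 : ℝ)) (bernsteinPolynomial.variance ℝ h)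
  simp only [Polynomial.eval_finsetSum, bernsteinPolynomial, Polynomial.eval_mul,
    Polynomial.eval_pow, Polynomial.eval_sub, Polynomial.eval_X, Polynomial.eval_natCast,
    Polynomial.eval_one, nsmul_eq_mul] at hv
  have : ∑ k ∈ range (h + 1), (h.choose k : ℝ) * (2 * k - h) ^ 2 =
      4 * 2 ^ h * ((h : ℝ) * (1 / 2) * (1 - 1 / 2)) := by
    rw [← hv, mul_sum]
    refine sum_congr rfl fun k hk => ?_
    have hk' : k ≤ h := by simpa [Nat.lt_succ_iff] using hk
    have : (2 : ℝ) ^ h * ((1 / 2) ^ k * (1 - 1 / 2) ^ (h - k)) = 1 := by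
      rw [show (1 - 1 / 2 : ℝ) = 1 / 2 by norm_num, ← pow_add, Nat.add_sub_cancel' hk', ← mul_pow]
      norm_num
    linear_combination (-(h.choose k : ℝ) * (2 * k - h) ^ 2) * this
  rw [this]; ring

/-- The `h`-subsets of a `2h`-set `U` that split `U ∩ A` into parts of sizes `w` and `v`. -/
theorem choose_mul_choose_le_card_filter {α : Type*} [DecidableEq α] (U A : Finset α) {h w v : ℕ}
    (hU : #U = 2 * h) (hw : w ≤ h) (hv : v ≤ h) (hUA : #(U ∩ A) = w + v) :
    h.choose w * h.choose v ≤ #{W ∈ powersetCard h U | #(W ∩ A) = w} := by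
  have hc := card_inter_add_card_sdiff U A
  obtain ⟨c, rfl⟩ := Nat.exists_eq_add_of_le hw
  obtain ⟨e, he⟩ := Nat.exists_eq_add_of_le hv
  rw [card_filter_card_inter_eq U A hw, hUA, show #(U \ A) = c + e by omega,
    Nat.add_sub_cancel_left]
  -- The count times `(2h).choose (w + v)` equals `h.choose w * h.choose v * (2h).choose h`, and the
  -- middle coefficient is the largest.
  have key := choose_mul_choose_mul_choose w v c e
  rw [← he] at key
  have hle : (w + c + (w + c)).choose (w + v) ≤ (w + c + (w + c)).choose (w + c) := by
    have := Nat.choose_le_middle (w + v) (w + c + (w + c))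
    rwa [show (w + c + (w + c)) / 2 = w + c by omega] at this
  have hpos : 0 < (w + c + (w + c)).choose (w + c) := Nat.choose_pos (by omega)
  apply Nat.le_of_mul_le_mul_right _ hpos
  rw [← key]
  exact Nat.mul_le_mul_left _ hle

/-- The total weight of the binomial coefficients below `τ`, by Chebyshev's inequality. -/
theorem sum_choose_lt_le (h : ℕ) {B : ℝ} (hB : 1 ≤ B) {τ : ℝ} (hτ : 0 ≤ τ) :
    ∑ k ∈ range (h + 1) with (h.choose k : ℝ) < τ, (h.choose k : ℝ) ≤
      h * 2 ^ h / B ^ 2 + 2 * B * τ := by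
  classical
  -- Indices with `|2k - h| ≥ B` are charged to the second moment. The others lie in an interval of
  -- length `B`, so there are at most `B + 1 ≤ 2 * B` of them, each contributing less than `τ`.
  rw [← sum_filter_add_sum_filter_not _ (fun k : ℕ => B ^ 2 ≤ (2 * (k : ℝ) - h) ^ 2)]
  apply add_le_add
  · rw [le_div_iff₀ (by positivity), ← sum_choose_mul_sq, sum_mul]
    calc _ ≤ ∑ k ∈ ((range (h + 1)).filter fun k => (h.choose k : ℝ) < τ).filter
            (fun k : ℕ => B ^ 2 ≤ (2 * (k : ℝ) - h) ^ 2),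
            (h.choose k : ℝ) * (2 * k - h) ^ 2 :=
          sum_le_sum fun k hk => mul_le_mul_of_nonneg_left (mem_filter.1 hk).2 (by positivity)
      _ ≤ _ := sum_le_sum_of_subset_of_nonneg
          ((filter_subset _ _).trans (filter_subset _ _)) fun _ _ _ => by positivity
  · set t := ((range (h + 1)).filter fun k => (h.choose k : ℝ) < τ).filter
      (fun k : ℕ => ¬ B ^ 2 ≤ (2 * (k : ℝ) - h) ^ 2) with ht
    have hsub : t.map Nat.castEmbedding ⊆ Icc ⌈(h - B) / 2⌉ ⌊(h + B) / 2⌋ := by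
      intro z hz
      obtain ⟨k, hk, rfl⟩ := mem_map.1 hz
      have hk2 := (mem_filter.1 hk).2
      have := abs_lt_of_sq_lt_sq (not_le.1 hk2) (by linarith)
      rw [abs_lt] at this
      rw [mem_Icc, Int.ceil_le, Int.le_floor]
      simp only [Nat.castEmbedding_apply, Int.cast_natCast]
      constructor <;> linarith
    have hcard : (#t : ℝ) ≤ 2 * B := by
      have h1 := card_le_card hsub
      rw [card_map, Int.card_Icc] at h1
      have h2 : (#t : ℝ) ≤ ((⌊(h + B) / 2⌋ + 1 - ⌈(h - B) / 2⌉).toNat : ℝ) := by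
        exact_mod_cast h1
      have h3 : ((⌊(h + B) / 2⌋ + 1 - ⌈(h - B) / 2⌉).toNat : ℝ) ≤ max (B + 1) 0 := by
        rw [← Int.cast_natCast, Int.toNat_eq_max, Int.cast_max]
        apply max_le_max _ (by simp)
        push_cast
        linarith [Int.floor_le ((h + B) / 2), Int.le_ceil ((h - B) / 2)]
      rw [max_eq_left (by linarith)] at h3
      linarith
    calc _ ≤ ∑ k ∈ t, τ := sum_le_sum fun k hk =>
          (mem_filter.1 (mem_filter.1 hk).1).2.le
      _ ≤ _ := by
        rw [sum_const, nsmul_eq_mul]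
        exact mul_le_mul_of_nonneg_right hcard hτ

/-! ### Typical intersections with a block -/

/-- The threshold for binomial coefficients `h.choose k` to count as not too small. -/
noncomputable def chooseThreshold (d h : ℕ) : ℝ := 2 ^ h / (1024 * d * Real.sqrt (h * d))

theorem sum_choose_lt_threshold_le {d h : ℕ} (hd : 0 < d) (hh : 0 < h) :
    ∑ k ∈ range (h + 1) with (h.choose k : ℝ) < chooseThreshold d h, (h.choose k : ℝ) ≤
      2 ^ h / (32 * d) := by
  have hd' : (1 : ℝ) ≤ d := by exact_mod_cast hd
  have hh' : (1 : ℝ) ≤ h := by exact_mod_cast hh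
  have hs : Real.sqrt (h * d) ^ 2 = h * d := Real.sq_sqrt (by positivity)
  have hs1 : 1 ≤ Real.sqrt (h * d) := Real.one_le_sqrt.2 (by nlinarith)
  -- With this `B`, the tail and the central window each contribute `2 ^ h / (64 * d)`.
  refine (sum_choose_lt_le h (B := 8 * Real.sqrt (h * d)) (by linarith)
    (by unfold chooseThreshold; positivity)).trans_eq ?_
  unfold chooseThreshold
  rw [mul_pow, hs]
  field_simp
  norm_num

/-- Few halving sets `A` have an atypical intersection with a fixed `h`-set `C`. -/
theorem card_filter_choose_lt_threshold_le {n d h : ℕ} (hd : 0 < d) (hh : 0 < h)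
    (hn : n = 2 * d * h) (C : Finset (Fin n)) (hC : #C = h) :
    (#{A ∈ powersetCard (n / 2) (univ : Finset (Fin n)) |
        ((h.choose #(C ∩ A) : ℕ) : ℝ) < chooseThreshold d h} : ℝ) ≤
      n.choose (n / 2) / (16 * d) := by
  classical
  set s := powersetCard (n / 2) (univ : Finset (Fin n))
  set bad := (range (h + 1)).filter fun k => ((h.choose k : ℕ) : ℝ) < chooseThreshold d h
  have h2 : 2 * h ≤ n := by rw [hn]; nlinarith
  have hle : {A ∈ s | ((h.choose #(C ∩ A) : ℕ) : ℝ) < chooseThreshold d h} ⊆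
      bad.biUnion fun k => {A ∈ s | #(A ∩ C) = k} := by
    intro A hA
    obtain ⟨hA1, hA2⟩ := mem_filter.1 hA
    refine mem_biUnion.2 ⟨#(C ∩ A), mem_filter.2 ⟨?_, hA2⟩, mem_filter.2 ⟨hA1, ?_⟩⟩
    · have := card_le_card (inter_subset_left : C ∩ A ⊆ C)
      rw [mem_range]; omega
    · rw [inter_comm]
  -- Up to a factor 2, the hypergeometric law of `#(A ∩ C)` is dominated by the symmetric binomial
  -- law.
  have heach : ∀ k ∈ bad, (#{A ∈ s | #(A ∩ C) = k} : ℝ) ≤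
      (h.choose k : ℝ) * (2 * n.choose (n / 2) / 2 ^ h) := by
    intro k hk
    have hk' : k < h + 1 := mem_range.1 (mem_filter.1 hk).1
    rw [card_filter_card_inter_eq univ C (by omega), univ_inter, hC,
      card_sdiff_of_subset (subset_univ _), hC, card_univ, Fintype.card_fin]
    push_cast
    apply mul_le_mul_of_nonneg_left _ (by positivity)
    rw [le_div_iff₀ (by positivity), mul_comm]
    exact_mod_cast two_pow_mul_choose_le ⟨d * h, by rw [hn]; ring⟩ (by omega) h2 _
  calc _ ≤ (#(bad.biUnion fun k => {A ∈ s | #(A ∩ C) = k}) : ℝ) := by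
        exact_mod_cast card_le_card hle
    _ ≤ ∑ k ∈ bad, (#{A ∈ s | #(A ∩ C) = k} : ℝ) := by exact_mod_cast card_biUnion_le
    _ ≤ ∑ k ∈ bad, (h.choose k : ℝ) * (2 * n.choose (n / 2) / 2 ^ h) := sum_le_sum heach
    _ ≤ 2 ^ h / (32 * d) * (2 * n.choose (n / 2) / 2 ^ h) := by
        rw [← sum_mul]
        exact mul_le_mul_of_nonneg_right (sum_choose_lt_threshold_le hd hh) (by positivity)
    _ = _ := by
        have : (0 : ℝ) < d := by exact_mod_cast hd
        field_simp
        ring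

/-! ### Chaining blocks into a balanced partition -/

/-- As the total vanishes, some `x a` is zero or has sign opposite to `p`; adding it cannot leave
`[-M, M]`. -/
theorem exists_abs_add_le {ι : Type*} (R : Finset ι) (hR : R.Nonempty) (x : ι → ℤ) {p M : ℤ}
    (hx : ∀ a, |x a| ≤ M) (hp : |p| ≤ M) (hsum : p + ∑ a ∈ R, x a = 0) :
    ∃ a ∈ R, |p + x a| ≤ M := by
  rcases le_total 0 p with h | h
  · obtain ⟨a, ha, hxa⟩ := exists_le_of_sum_le hR (f := x) (g := fun _ => 0)
      (by simp only [sum_const_zero]; omega)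
    have h1 := abs_le.1 (hx a)
    have h2 := abs_le.1 hp
    exact ⟨a, ha, abs_le.2 ⟨by omega, by omega⟩⟩
  · obtain ⟨a, ha, hxa⟩ := exists_le_of_sum_le hR (f := fun _ => 0) (g := x)
      (by simp only [sum_const_zero]; omega)
    have h1 := abs_le.1 (hx a)
    have h2 := abs_le.1 hp
    exact ⟨a, ha, abs_le.2 ⟨by omega, by omega⟩⟩

/-- Chaining: starting from a piece `P`, repeatedly take two unused blocks `C a`, `C b`, complete `P`
to a balanced set with half of `C a ∪ C b`, and continue with the other half. -/
theorem exists_balanced_partition {n h : ℕ} {ι : Type*} [DecidableEq ι]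
    (C : ι → Finset (Fin n)) (hC : ∀ a, #(C a) = h)
    (hdisj : ∀ a b, a ≠ b → Disjoint (C a) (C b)) (A : Finset (Fin n))
    (pcs : Finset (Finset (Fin n))) (hpc : ∀ a, C a ∈ pcs) (M : ℤ)
    (hM : ∀ a, |2 * (#(C a ∩ A) : ℤ) - h| ≤ M)
    (hsplit : ∀ a b, a ≠ b → ∀ w v : ℕ, w + v = #(C a ∩ A) + #(C b ∩ A) →
      |2 * (w : ℤ) - h| ≤ M → |2 * (v : ℤ) - h| ≤ M →
      ∃ W ⊆ C a ∪ C b, W ∈ pcs ∧ (C a ∪ C b) \ W ∈ pcs ∧ #W = h ∧ #(W ∩ A) = w)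
    (hMh : M ≤ h) (j : ℕ) :
    ∀ (R : Finset ι) (P : Finset (Fin n)), #R = 2 * j + 1 → P ∈ pcs → #P = h →
      (∀ a ∈ R, Disjoint P (C a)) → |2 * (#(P ∩ A) : ℤ) - h| ≤ M →
      2 * (#(P ∩ A) : ℤ) - h + ∑ a ∈ R, (2 * (#(C a ∩ A) : ℤ) - h) = 0 →
      ∃ S : Fin (j + 1) → Finset (Fin n),
        (∀ i, ∃ X ∈ pcs, ∃ Y ∈ pcs, S i = X ∪ Y) ∧ (∀ i, #(S i) = 2 * h) ∧
        (∀ i k, i ≠ k → Disjoint (S i) (S k)) ∧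
        univ.biUnion S = P ∪ R.biUnion C ∧ ∀ i, BalancedOn (S i) A := by
  have hbal : ∀ {X Y : Finset (Fin n)}, Disjoint X Y → #X = h → #Y = h →
      #(X ∩ A) + #(Y ∩ A) = h → #(X ∪ Y) = 2 * h ∧ BalancedOn (X ∪ Y) A := by
    intro X Y hXY hX hY hXYA
    have h1 : #(X ∪ Y) = 2 * h := by rw [card_union_of_disjoint hXY]; omega
    refine ⟨h1, ?_⟩
    rw [BalancedOn, h1, union_inter_distrib_right, card_union_of_disjoint
      (disjoint_of_subset_left inter_subset_left (disjoint_of_subset_right inter_subset_left hXY)),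
      hXYA]
  induction j with
  | zero =>
    intro R P hR hP hPc hPR hPM hsum
    obtain ⟨a, rfl⟩ := card_eq_one.1 (by simpa using hR)
    rw [sum_singleton] at hsum
    obtain ⟨h1, h2⟩ := hbal (hPR a (mem_singleton_self a)) hPc (hC a) (by omega)
    refine ⟨fun _ => P ∪ C a, fun _ => ⟨P, hP, C a, hpc a, rfl⟩, fun _ => h1, ?_, ?_, fun _ => h2⟩
    · intro i k hik
      exact absurd (Fin.ext (by omega)) hik
    · simp
  | succ j ih =>
    intro R P hR hP hPc hPR hPM hsum
    -- `a` and `b` are chosen so that the imbalance of `P`, increased by theirs, stays within `M`;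
    -- this sum is the imbalance of the half carried on.
    obtain ⟨a, ha, hpa⟩ := exists_abs_add_le R (card_pos.1 (by omega)) _ hM hPM hsum
    have hsum' := hsum
    rw [← add_sum_erase R _ ha, ← add_assoc] at hsum'
    have hRa := card_erase_of_mem ha
    obtain ⟨b, hb, hpb⟩ := exists_abs_add_le (R.erase a) (card_pos.1 (by omega)) _ hM hpa hsum'
    rw [← add_sum_erase (R.erase a) _ hb, ← add_assoc] at hsum'
    have hRb := card_erase_of_mem hb
    have hba : b ≠ a := ne_of_mem_erase hb
    have hbR : b ∈ R := mem_of_mem_erase hb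
    have hPA : #(P ∩ A) ≤ h := by
      rw [← hPc]; exact card_le_card inter_subset_left
    -- `M ≤ h` enters here and makes the natural subtraction in the choice of `v` exact.
    have hlow : h ≤ #(P ∩ A) + (#(C a ∩ A) + #(C b ∩ A)) := by
      have := abs_le.1 hpb
      omega
    -- `w` is what `P` lacks to be balanced, so the imbalance of `W` is minus that of `P`; `v` is
    -- left for the other half.
    obtain ⟨W, hWab, hW, hW', hWc, hWA⟩ := hsplit a b hba.symm (h - #(P ∩ A))
      (#(P ∩ A) + (#(C a ∩ A) + #(C b ∩ A)) - h) (by omega)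
      (by rw [← abs_neg]; convert hPM using 2; omega) (by convert hpb using 2; omega)
    have hPab : Disjoint P (C a ∪ C b) := disjoint_union_right.2 ⟨hPR a ha, hPR b hbR⟩
    obtain ⟨h1, h2⟩ := hbal (disjoint_of_subset_right hWab hPab) hPc hWc (by omega)
    have habc : #(C a ∪ C b) = 2 * h := by
      rw [card_union_of_disjoint (hdisj a b hba.symm), hC, hC]; ring
    have hP'A : #(((C a ∪ C b) \ W) ∩ A) = #(P ∩ A) + (#(C a ∩ A) + #(C b ∩ A)) - h := by
      have e1 : ((C a ∪ C b) \ W) ∩ A = ((C a ∪ C b) ∩ A) \ (W ∩ A) := by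
        ext z; simp only [mem_inter, mem_sdiff]; tauto
      rw [e1, card_sdiff_of_subset (inter_subset_inter_right hWab), union_inter_distrib_right,
        card_union_of_disjoint (disjoint_of_subset_left inter_subset_left
          (disjoint_of_subset_right inter_subset_left (hdisj a b hba.symm))), hWA]
      omega
    obtain ⟨S, hS1, hS2, hS3, hS4, hS5⟩ := ih ((R.erase a).erase b) ((C a ∪ C b) \ W) (by omega)
      hW' (by rw [card_sdiff_of_subset hWab]; omega)
      (by
        intro c hc
        have hcb := ne_of_mem_erase hc
        have hca := ne_of_mem_erase (mem_of_mem_erase hc)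
        exact disjoint_of_subset_left sdiff_subset
          (disjoint_union_left.2 ⟨hdisj a c hca.symm, hdisj b c hcb.symm⟩))
      (by rw [hP'A]; convert hpb using 2; omega)
      (by rw [hP'A]; convert hsum' using 2; omega)
    have hunion : ((C a ∪ C b) \ W) ∪ ((R.erase a).erase b).biUnion C ∪ W = R.biUnion C := by
      conv_rhs => rw [← insert_erase ha, ← insert_erase hb, biUnion_insert, biUnion_insert]
      ext z
      have := @hWab z
      simp only [mem_union, mem_sdiff] at this ⊢
      tauto
    have hnew : ∀ i, Disjoint (P ∪ W) (S i) := by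
      intro i
      have hsub : S i ⊆ ((C a ∪ C b) \ W) ∪ ((R.erase a).erase b).biUnion C := by
        rw [← hS4]; exact subset_biUnion_of_mem S (mem_univ i)
      refine disjoint_of_subset_right hsub (disjoint_union_left.2 ⟨?_, ?_⟩)
      · refine disjoint_union_right.2 ⟨disjoint_of_subset_right sdiff_subset hPab, ?_⟩
        exact (disjoint_biUnion_right _ _ _).2 fun c hc =>
          hPR c (mem_of_mem_erase (mem_of_mem_erase hc))
      · refine disjoint_union_right.2 ⟨disjoint_sdiff, ?_⟩
        refine (disjoint_biUnion_right _ _ _).2 fun c hc => ?_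
        have hcb := ne_of_mem_erase hc
        have hca := ne_of_mem_erase (mem_of_mem_erase hc)
        exact disjoint_of_subset_left hWab
          (disjoint_union_left.2 ⟨hdisj a c hca.symm, hdisj b c hcb.symm⟩)
    refine ⟨Fin.cons (P ∪ W) S, ?_, ?_, ?_, ?_, ?_⟩
    · exact Fin.cases ⟨P, hP, W, hW, rfl⟩ hS1
    · exact Fin.cases h1 hS2
    · intro i k
      induction i using Fin.cases with
      | zero =>
        induction k using Fin.cases with
        | zero => intro h; exact absurd rfl h
        | succ k => intro _; exact hnew k
      | succ i =>
        induction k using Fin.cases with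
        | zero => intro _; exact (hnew i).symm
        | succ k => intro h; exact hS3 i k fun e => h (by rw [e])
    · rw [← hunion, ← hS4]
      ext z
      simp only [mem_biUnion, mem_univ, true_and, Fin.exists_fin_succ, Fin.cons_zero,
        Fin.cons_succ, mem_union]
      tauto
    · exact Fin.cases h2 hS5

/-! ### Random splits of a pair of blocks -/

/-- A lower bound for the probability that a random half of two blocks has a prescribed typical
intersection with a set. -/
noncomputable def hitProb (d h : ℕ) : ℝ := 1 / (2 ^ 20 * d ^ 3 * Real.sqrt h)

theorem hitProb_le_one {d h : ℕ} (hd : 0 < d) (hh : 0 < h) : hitProb d h ≤ 1 := by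
  have hd' : (1 : ℝ) ≤ d := by exact_mod_cast hd
  have hs : 1 ≤ Real.sqrt h := Real.one_le_sqrt.2 (by exact_mod_cast hh)
  unfold hitProb
  rw [div_le_one (by positivity)]
  have : (1 : ℝ) ≤ (d : ℝ) ^ 3 := one_le_pow₀ hd'
  nlinarith

theorem chooseThreshold_pos {d h : ℕ} (hd : 0 < d) (hh : 0 < h) : 0 < chooseThreshold d h := by
  unfold chooseThreshold; positivity

/-- The squared threshold is `4 ^ h / (2 ^ 20 * d ^ 3 * h)`, while `(2h).choose h ≤ 4 ^ h / √h`; so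
only `√h` is lost in the probability. -/
theorem hitProb_mul_choose_le {d h : ℕ} (hd : 0 < d) (hh : 0 < h) :
    hitProb d h * ((2 * h).choose h : ℝ) ≤ chooseThreshold d h ^ 2 := by
  have hd' : (0 : ℝ) < d := by exact_mod_cast hd
  have hh' : (0 : ℝ) < h := by exact_mod_cast hh
  have h1 : ((2 * h).choose h : ℝ) * Real.sqrt h ≤ 4 ^ h := by
    apply abs_le_of_sq_le_sq' _ (by positivity) |>.2
    rw [mul_pow, Real.sq_sqrt hh'.le, ← pow_mul, mul_comm h 2, pow_mul]
    have h2 : (((2 * h).choose h : ℕ) : ℝ) ^ 2 * (2 * h + 1) ≤ 16 ^ h := by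
      exact_mod_cast sq_centralBinom_mul_le h
    norm_num
    refine le_trans ?_ h2
    apply mul_le_mul_of_nonneg_left _ (by positivity)
    linarith
  unfold hitProb chooseThreshold
  rw [div_pow, mul_pow, Real.sq_sqrt (by positivity), ← pow_mul, mul_comm h 2, pow_mul]
  have hs : 0 < Real.sqrt h := Real.sqrt_pos.2 hh'
  have hss : Real.sqrt h * Real.sqrt h = h := Real.mul_self_sqrt hh'.le
  rw [one_div_mul_eq_div, div_le_div_iff₀ (by positivity) (by positivity)]
  calc ((2 * h).choose h : ℝ) * ((1024 * d) ^ 2 * (h * d))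
      = ((2 * h).choose h * Real.sqrt h) * (2 ^ 20 * d ^ 3 * Real.sqrt h) := by
        linear_combination (-(2 ^ 20 * ((2 * h).choose h : ℝ) * d ^ 3)) * hss
    _ ≤ 4 ^ h * (2 ^ 20 * d ^ 3 * Real.sqrt h) :=
        mul_le_mul_of_nonneg_right h1 (by positivity)
    _ = _ := by norm_num

/-- `A` can be split in every typical way on `U` by a member of `G`. -/
def SplitsTypically {n : ℕ} (d h : ℕ) (U : Finset (Fin n)) (G : Finset (Finset (Fin n)))
    (A : Finset (Fin n)) : Prop :=
  ∀ w v : ℕ, w + v = #(U ∩ A) → chooseThreshold d h ≤ h.choose w →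
    chooseThreshold d h ≤ h.choose v → ∃ W ∈ G, #(W ∩ A) = w

open Classical in
theorem exists_splitting_family {n d h : ℕ} (hd : 0 < d) (hh : 0 < h) (U : Finset (Fin n))
    (hU : #U = 2 * h) (s : Finset (Finset (Fin n))) (K : ℕ) :
    ∃ G ⊆ powersetCard h U, #G ≤ K ∧
      (#{A ∈ s | ¬ SplitsTypically d h U G A} : ℝ) ≤ (1 - hitProb d h) ^ K * ((h + 1) * #s) := by
  have le_of_threshold : ∀ {w : ℕ}, chooseThreshold d h ≤ h.choose w → w ≤ h := by
    intro w hw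
    by_contra hlt
    rw [Nat.choose_eq_zero_of_lt (not_le.1 hlt), Nat.cast_zero] at hw
    exact absurd hw (not_le.2 (chooseThreshold_pos hd hh))
  set t : Finset (Finset (Fin n) × ℕ) := {p ∈ s ×ˢ range (h + 1) |
    ∃ v, p.2 + v = #(U ∩ p.1) ∧ chooseThreshold d h ≤ h.choose p.2 ∧
      chooseThreshold d h ≤ h.choose v} with ht
  obtain ⟨G, hG, hGK, hGt⟩ := exists_greedy_cover t (powersetCard h U)
    (fun p W => #(W ∩ p.1) = p.2) (hitProb_le_one hd hh)
    (powersetCard_nonempty.2 (by omega)) (by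
      rintro ⟨A, w⟩ hp
      obtain ⟨v, hwv, hw, hv⟩ := (mem_filter.1 hp).2
      rw [card_powersetCard, hU]
      refine (hitProb_mul_choose_le hd hh).trans ?_
      have := choose_mul_choose_le_card_filter U A hU (le_of_threshold hw) (le_of_threshold hv)
        hwv.symm
      calc chooseThreshold d h ^ 2 ≤ (h.choose w : ℝ) * h.choose v := by
            rw [sq]; exact mul_le_mul hw hv (chooseThreshold_pos hd hh).le (by positivity)
        _ ≤ _ := by exact_mod_cast this) K
  refine ⟨G, hG, hGK, ?_⟩
  have hsub : {A ∈ s | ¬ SplitsTypically d h U G A} ⊆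
      ({p ∈ t | ∀ W ∈ G, ¬ #(W ∩ p.1) = p.2}).image Prod.fst := by
    intro A hA
    obtain ⟨hAs, hA⟩ := mem_filter.1 hA
    unfold SplitsTypically at hA
    push Not at hA
    obtain ⟨w, v, hwv, hw, hv, hG⟩ := hA
    refine mem_image.2 ⟨(A, w), mem_filter.2 ⟨mem_filter.2 ⟨mem_product.2 ⟨hAs, ?_⟩,
      v, hwv, hw, hv⟩, hG⟩, rfl⟩
    have := le_of_threshold hw
    exact mem_range.2 (by simp only; omega)
  have hts : (#t : ℝ) ≤ (h + 1) * #s := by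
    have := card_filter_le (s ×ˢ range (h + 1)) fun p => ∃ v, p.2 + v = #(U ∩ p.1) ∧
      chooseThreshold d h ≤ h.choose p.2 ∧ chooseThreshold d h ≤ h.choose v
    rw [card_product, card_range] at this
    rw [mul_comm]
    exact_mod_cast this
  calc _ ≤ (#{p ∈ t | ∀ W ∈ G, ¬ #(W ∩ p.1) = p.2} : ℝ) := by
        exact_mod_cast (card_le_card hsub).trans card_image_le
    _ ≤ (1 - hitProb d h) ^ K * #t := by convert hGt
    _ ≤ _ := mul_le_mul_of_nonneg_left hts
        (pow_nonneg (by linarith [hitProb_le_one hd hh]) _)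

/-! ### A family handling half of the halving sets -/

theorem exists_blocks {n m h : ℕ} (hn : n = m * h) :
    ∃ C : Fin m → Finset (Fin n), (∀ a, #(C a) = h) ∧
      (∀ a b, a ≠ b → Disjoint (C a) (C b)) ∧ univ.biUnion C = univ := by
  subst hn
  refine ⟨fun a => univ.map ⟨fun i => finProdFinEquiv (a, i), fun i j hij => by
    simpa using hij⟩, by simp, ?_, ?_⟩
  · intro a b hab
    rw [disjoint_left]
    rintro x hx hy
    simp only [mem_map, mem_univ, true_and] at hx hy
    obtain ⟨i, rfl⟩ := hx
    obtain ⟨j, hj⟩ := hy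
    have := finProdFinEquiv.injective hj
    exact hab (congrArg Prod.fst this).symm
  · ext x
    simp only [mem_biUnion, mem_map, mem_univ, true_and, iff_true]
    exact ⟨(finProdFinEquiv.symm x).1, (finProdFinEquiv.symm x).2,
      finProdFinEquiv.apply_symm_apply x⟩

/-- A set with typical intersections with all blocks that can be split typically on each pair of
blocks is handled by the unions of two pieces. -/
theorem isHandledBy_of_typical {n d h : ℕ} (hd : 0 < d) (hn : n = 2 * d * h)
    (C : Fin (2 * d) → Finset (Fin n)) (hC : ∀ a, #(C a) = h)
    (hdisj : ∀ a b, a ≠ b → Disjoint (C a) (C b)) (hcov : univ.biUnion C = univ)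
    (G : Fin (2 * d) → Fin (2 * d) → Finset (Finset (Fin n)))
    (hG : ∀ a b, a ≠ b → G a b ⊆ powersetCard h (C a ∪ C b))
    (pcs : Finset (Finset (Fin n))) (hCp : ∀ a, C a ∈ pcs)
    (hGp : ∀ a b, ∀ W ∈ G a b, W ∈ pcs ∧ (C a ∪ C b) \ W ∈ pcs)
    (F : Finset (Finset (Fin n)))
    (hF : ∀ X ∈ pcs, ∀ Y ∈ pcs, #(X ∪ Y) = 2 * h → X ∪ Y ∈ F)
    (A : Finset (Fin n)) (hA : #A = n / 2)
    (htyp : ∀ a, chooseThreshold d h ≤ (h.choose #(C a ∩ A) : ℕ))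
    (hsp : ∀ a b, a ≠ b → SplitsTypically d h (C a ∪ C b) (G a b) A) :
    IsHandledBy d F A := by
  have hle : ∀ a, #(C a ∩ A) ≤ h := fun a => by
    rw [← hC a]; exact card_le_card inter_subset_left
  have : Nonempty (Fin (2 * d)) := ⟨⟨0, by omega⟩⟩
  -- The chain starts at the worst block `m`, whose imbalance serves as `M`. By unimodality, every
  -- `w` with imbalance at most `M` has a coefficient at least that of block `m`, hence above the
  -- threshold.
  obtain ⟨m, -, hm⟩ := exists_max_image (univ : Finset (Fin (2 * d)))
    (fun a => |2 * (#(C a ∩ A) : ℤ) - h|) univ_nonempty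
  have hMh : |2 * (#(C m ∩ A) : ℤ) - h| ≤ h := abs_le.2 ⟨by omega, by have := hle m; omega⟩
  have hth : ∀ w : ℕ, |2 * (w : ℤ) - h| ≤ |2 * (#(C m ∩ A) : ℤ) - h| →
      chooseThreshold d h ≤ (h.choose w : ℕ) := by
    intro w hw
    have hwh := abs_le.1 (hw.trans hMh)
    exact (htyp m).trans (by exact_mod_cast choose_le_choose_of_abs_le (hle m) (by omega) hw)
  have hcount : ∑ a, #(C a ∩ A) = d * h := by
    have h1 : univ.biUnion (fun a => C a ∩ A) = A := by
      rw [← biUnion_inter, hcov, univ_inter]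
    rw [← card_biUnion, h1, hA, hn, mul_assoc, Nat.mul_div_cancel_left _ two_pos]
    intro a _ b _ hab
    exact disjoint_of_subset_left inter_subset_left
      (disjoint_of_subset_right inter_subset_left (hdisj a b hab))
  have hsum : ∑ a, (2 * (#(C a ∩ A) : ℤ) - h) = 0 := by
    rw [sum_sub_distrib, ← mul_sum, sum_const, card_univ, Fintype.card_fin, nsmul_eq_mul]
    have : (∑ a, (#(C a ∩ A) : ℤ)) = d * h := by exact_mod_cast hcount
    rw [this]; push_cast; ring
  obtain ⟨j, rfl⟩ : ∃ j, d = j + 1 := ⟨d - 1, by omega⟩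
  obtain ⟨S, hS1, hS2, hS3, hS4, hS5⟩ := exists_balanced_partition C hC hdisj A pcs hCp
    |2 * (#(C m ∩ A) : ℤ) - h| (fun a => hm a (mem_univ a)) (by
      intro a b hab w v hwv hw hv
      have hUA : w + v = #((C a ∪ C b) ∩ A) := by
        rw [union_inter_distrib_right, card_union_of_disjoint, hwv]
        exact disjoint_of_subset_left inter_subset_left
          (disjoint_of_subset_right inter_subset_left (hdisj a b hab))
      obtain ⟨W, hW, hWA⟩ := hsp a b hab w v hUA (hth w hw) (hth v hv)
      obtain ⟨hW1, hW2⟩ := mem_powersetCard.1 (hG a b hab hW)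
      exact ⟨W, hW1, (hGp a b W hW).1, (hGp a b W hW).2, hW2, hWA⟩) hMh j
    (univ.erase m) (C m) (by
      rw [card_erase_of_mem (mem_univ m), card_univ, Fintype.card_fin]; omega) (hCp m) (hC m)
    (fun a ha => hdisj m a (ne_of_mem_erase ha).symm) le_rfl
    (by rw [add_sum_erase univ (fun a => 2 * (#(C a ∩ A) : ℤ) - h) (mem_univ m)]; exact hsum)
  refine ⟨S, ?_, hS3, ?_, hS5⟩
  · intro i
    obtain ⟨X, hX, Y, hY, hXY⟩ := hS1 i
    rw [hXY]
    exact hF X hX Y hY (hXY ▸ hS2 i)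
  · rw [hS4, ← biUnion_insert, insert_erase (mem_univ m), hcov]

open Classical in
/-- A small family that handles at least half of all halving sets. -/
theorem exists_family_handling_half {n d h : ℕ} (hd : 0 < d) (hh : 0 < h) (hn : n = 2 * d * h)
    {K : ℕ} (hK : (1 - hitProb d h) ^ K * (16 * d ^ 2 * (h + 1)) ≤ 1) :
    ∃ F ⊆ powersetCard (n / d) (univ : Finset (Fin n)),
      #F ≤ (2 * d + 8 * d ^ 2 * K) ^ 2 ∧
      (n.choose (n / 2) : ℝ) / 2 ≤
        #{A ∈ powersetCard (n / 2) (univ : Finset (Fin n)) | IsHandledBy d F A} := by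
  have hd' : (0 : ℝ) < d := by exact_mod_cast hd
  obtain ⟨C, hC, hdisj, hcov⟩ := exists_blocks (m := 2 * d) hn
  set s := powersetCard (n / 2) (univ : Finset (Fin n)) with hs
  have hscard : #s = n.choose (n / 2) := by simp [hs]
  have hG : ∀ a b : Fin (2 * d), ∃ G : Finset (Finset (Fin n)), #G ≤ K ∧ (a ≠ b →
      G ⊆ powersetCard h (C a ∪ C b) ∧
      (#{A ∈ s | ¬ SplitsTypically d h (C a ∪ C b) G A} : ℝ) ≤
        (1 - hitProb d h) ^ K * ((h + 1) * #s)) := by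
    intro a b
    by_cases hab : a = b
    · exact ⟨∅, by simp, fun h => absurd hab h⟩
    · obtain ⟨G, h1, h2, h3⟩ := exists_splitting_family hd hh (C a ∪ C b)
        (by rw [card_union_of_disjoint (hdisj a b hab), hC, hC]; ring) s K
      exact ⟨G, h2, fun _ => ⟨h1, h3⟩⟩
  choose G hGK hG using hG
  set pcs : Finset (Finset (Fin n)) := univ.image C ∪
    univ.biUnion (fun p : Fin (2 * d) × Fin (2 * d) =>
      G p.1 p.2 ∪ (G p.1 p.2).image fun W => (C p.1 ∪ C p.2) \ W) with hpcs
  have hpc : #pcs ≤ 2 * d + 8 * d ^ 2 * K := by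
    refine (card_union_le _ _).trans (add_le_add ?_ ?_)
    · exact card_image_le.trans (by simp)
    · refine (card_biUnion_le_card_mul _ _ (2 * K) fun p _ => ?_).trans ?_
      · refine (card_union_le _ _).trans ?_
        have h1 := hGK p.1 p.2
        have h2 : #((G p.1 p.2).image fun W => (C p.1 ∪ C p.2) \ W) ≤ #(G p.1 p.2) :=
          card_image_le
        omega
      · rw [card_univ, Fintype.card_prod, Fintype.card_fin]
        exact le_of_eq (by ring)
  have hCp : ∀ a, C a ∈ pcs := fun a => mem_union_left _ (mem_image_of_mem C (mem_univ a))
  have hGp : ∀ a b, ∀ W ∈ G a b, W ∈ pcs ∧ (C a ∪ C b) \ W ∈ pcs := fun a b W hW =>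
    ⟨mem_union_right _ (mem_biUnion.2 ⟨(a, b), mem_univ _, mem_union_left _ hW⟩),
      mem_union_right _ (mem_biUnion.2 ⟨(a, b), mem_univ _,
        mem_union_right _ (mem_image_of_mem (fun W => (C a ∪ C b) \ W) hW)⟩)⟩
  have hnd : n / d = 2 * h := by
    rw [hn, show 2 * d * h = d * (2 * h) by ring, Nat.mul_div_cancel_left _ hd]
  -- The filter discards overlapping unions, and also unions of the wrong size coming from the
  -- unconstrained diagonal families `G a a`.
  set F := ((pcs ×ˢ pcs).image fun p => p.1 ∪ p.2).filter fun S => #S = 2 * h with hFdef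
  refine ⟨F, ?_, ?_, ?_⟩
  · intro S hS
    rw [mem_powersetCard, hnd]
    exact ⟨subset_univ _, (mem_filter.1 hS).2⟩
  · refine (card_filter_le _ _).trans (card_image_le.trans ?_)
    rw [card_product, sq]
    exact Nat.mul_le_mul hpc hpc
  -- Atypical blocks cost at most `2d / (16d) = 1/8` of `s`, and badly split pairs at most `4d² /
  -- (16d²) = 1/4`; together less than half.
  set bad := univ.biUnion (fun a =>
      {A ∈ s | ((h.choose #(C a ∩ A) : ℕ) : ℝ) < chooseThreshold d h}) ∪
    (univ.filter fun p : Fin (2 * d) × Fin (2 * d) => p.1 ≠ p.2).biUnion (fun p =>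
      {A ∈ s | ¬ SplitsTypically d h (C p.1 ∪ C p.2) (G p.1 p.2) A}) with hbad
  have hbad1 : (#bad : ℝ) ≤ #s / 2 := by
    have e1 : (#(univ.biUnion fun a => {A ∈ s | ((h.choose #(C a ∩ A) : ℕ) : ℝ) <
        chooseThreshold d h}) : ℝ) ≤ #s / 8 := by
      calc _ ≤ ∑ a, (#{A ∈ s | ((h.choose #(C a ∩ A) : ℕ) : ℝ) < chooseThreshold d h} : ℝ) := by
            exact_mod_cast card_biUnion_le
        _ ≤ ∑ _a : Fin (2 * d), (#s / (16 * d) : ℝ) := by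
            rw [hscard]
            exact sum_le_sum fun a _ => card_filter_choose_lt_threshold_le hd hh hn (C a) (hC a)
        _ = _ := by
            rw [sum_const, card_univ, Fintype.card_fin, nsmul_eq_mul]
            push_cast
            field_simp
            ring
    have e2 : (#((univ.filter fun p : Fin (2 * d) × Fin (2 * d) => p.1 ≠ p.2).biUnion (fun p =>
        {A ∈ s | ¬ SplitsTypically d h (C p.1 ∪ C p.2) (G p.1 p.2) A})) : ℝ) ≤ #s / 4 := by
      calc _ ≤ ∑ p ∈ univ.filter fun p : Fin (2 * d) × Fin (2 * d) => p.1 ≠ p.2,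
              (#{A ∈ s | ¬ SplitsTypically d h (C p.1 ∪ C p.2) (G p.1 p.2) A} : ℝ) := by
            exact_mod_cast card_biUnion_le
        _ ≤ ∑ p ∈ univ.filter fun p : Fin (2 * d) × Fin (2 * d) => p.1 ≠ p.2,
              (1 - hitProb d h) ^ K * ((h + 1) * #s) :=
            sum_le_sum fun p hp => (hG p.1 p.2 (mem_filter.1 hp).2).2
        _ ≤ (4 * d ^ 2) * ((1 - hitProb d h) ^ K * ((h + 1) * #s)) := by
            rw [sum_const, nsmul_eq_mul]
            apply mul_le_mul_of_nonneg_right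
            · have := card_filter_le (univ : Finset (Fin (2 * d) × Fin (2 * d)))
                fun p => p.1 ≠ p.2
              rw [card_univ, Fintype.card_prod, Fintype.card_fin] at this
              have h2 : ((#{p : Fin (2 * d) × Fin (2 * d) | p.1 ≠ p.2} : ℕ) : ℝ) ≤
                  ((2 * d * (2 * d) : ℕ) : ℝ) := by exact_mod_cast this
              refine h2.trans (le_of_eq ?_)
              push_cast; ring
            · exact mul_nonneg (pow_nonneg (by linarith [hitProb_le_one hd hh]) _) (by positivity)
        _ = ((1 - hitProb d h) ^ K * (16 * d ^ 2 * (h + 1))) * (#s / 4) := by ring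
        _ ≤ 1 * (#s / 4) := mul_le_mul_of_nonneg_right hK (by positivity)
        _ = _ := one_mul _
    have e3 : (#bad : ℝ) ≤ (#(univ.biUnion fun a => {A ∈ s | ((h.choose #(C a ∩ A) : ℕ) : ℝ) <
        chooseThreshold d h}) : ℝ) + #((univ.filter fun p : Fin (2 * d) × Fin (2 * d) =>
        p.1 ≠ p.2).biUnion (fun p =>
          {A ∈ s | ¬ SplitsTypically d h (C p.1 ∪ C p.2) (G p.1 p.2) A})) := by
      exact_mod_cast card_union_le _ _
    have : (0 : ℝ) ≤ #s := by positivity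
    linarith
  have hsub : s \ bad ⊆ {A ∈ s | IsHandledBy d F A} := by
    intro A hA
    obtain ⟨hAs, hAb⟩ := mem_sdiff.1 hA
    refine mem_filter.2 ⟨hAs, ?_⟩
    simp only [hbad, mem_union, mem_biUnion, mem_filter, mem_univ, true_and, hAs, not_or,
      not_exists, not_lt, not_and, not_not] at hAb
    refine isHandledBy_of_typical hd hn C hC hdisj hcov G (fun a b hab => (hG a b hab).1) pcs hCp
      hGp F ?_ A (mem_powersetCard.1 hAs).2 hAb.1 (fun a b hab => hAb.2 (a, b) hab)
    intro X hX Y hY hXY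
    exact mem_filter.2 ⟨mem_image.2 ⟨(X, Y), mem_product.2 ⟨hX, hY⟩, rfl⟩, hXY⟩
  have e4 : #s ≤ #(s \ bad) + #bad := by
    have := le_card_sdiff bad s
    omega
  have e5 : (#s : ℝ) ≤ #(s \ bad) + #bad := by exact_mod_cast e4
  have e6 : (#(s \ bad) : ℝ) ≤ #{A ∈ s | IsHandledBy d F A} := by
    exact_mod_cast card_le_card hsub
  rw [← hscard]
  linarith

/-! ### Symmetrisation by permutations -/

theorem exists_perm_map_eq {α : Type*} [Fintype α] [DecidableEq α] {A B : Finset α}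
    (h : #A = #B) : ∃ τ : Equiv.Perm α, A.map τ.toEmbedding = B := by
  let e : {x // x ∈ A} ≃ {x // x ∈ B} := equivOfCardEq h
  refine ⟨e.extendSubtype, eq_of_subset_of_card_le ?_ (by rw [card_map, h])⟩
  intro y hy
  obtain ⟨x, hx, rfl⟩ := mem_map.1 hy
  exact e.extendSubtype_mem x hx

theorem IsHandledBy.mono {n d : ℕ} {F F' : Finset (Finset (Fin n))} {A : Finset (Fin n)}
    (hA : IsHandledBy d F A) (hF : F ⊆ F') : IsHandledBy d F' A := by
  obtain ⟨S, h1, h2⟩ := hA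
  exact ⟨S, fun i => hF (h1 i), h2⟩

theorem IsHandledBy.image_symm {n d : ℕ} {F : Finset (Finset (Fin n))} {A : Finset (Fin n)}
    (σ : Equiv.Perm (Fin n)) (hA : IsHandledBy d F (A.map σ.toEmbedding)) :
    IsHandledBy d (F.image fun S => S.map σ.symm.toEmbedding) A := by
  obtain ⟨S, h1, h2, h3, h4⟩ := hA
  refine ⟨fun i => (S i).map σ.symm.toEmbedding, fun i => mem_image_of_mem _ (h1 i),
    fun i j hij => (disjoint_map _).2 (h2 i j hij), ?_, fun i => ?_⟩
  · ext x
    have hx : σ x ∈ univ.biUnion S := by rw [h3]; exact mem_univ _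
    obtain ⟨i, -, hi⟩ := mem_biUnion.1 hx
    simp only [mem_univ, iff_true, mem_biUnion, true_and]
    exact ⟨i, mem_map.2 ⟨σ x, hi, by simp⟩⟩
  · have hA' : A = (A.map σ.toEmbedding).map σ.symm.toEmbedding := by
      ext x; simp
    have := h4 i
    unfold BalancedOn at this ⊢
    rw [hA', ← map_inter, card_map, card_map, this]

open Classical in
/-- A random permutation takes a fixed set into a `q`-fraction of the sets of its size with
probability `q`. -/
theorem le_card_filter_perm {n r : ℕ} (p : Finset (Fin n) → Prop) {q : ℝ}
    (hp : q * n.choose r ≤ #{A ∈ powersetCard r (univ : Finset (Fin n)) | p A})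
    {A : Finset (Fin n)} (hA : A ∈ powersetCard r univ) :
    q * (#(univ : Finset (Equiv.Perm (Fin n))) : ℝ) ≤
      #{σ : Equiv.Perm (Fin n) | p (A.map σ.toEmbedding)} := by
  set s := powersetCard r (univ : Finset (Fin n)) with hs
  have hscard : #s = n.choose r := by simp [hs]
  -- Pairs `(B, σ)` are counted in two ways: by transitivity the number of good `σ` does not depend
  -- on `B`, and the number of good `B` does not depend on `σ`.
  have hconst : ∀ B ∈ s, #{σ : Equiv.Perm (Fin n) | p (B.map σ.toEmbedding)} =
      #{σ : Equiv.Perm (Fin n) | p (A.map σ.toEmbedding)} := by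
    intro B hB
    obtain ⟨τ, rfl⟩ := exists_perm_map_eq
      ((mem_powersetCard.1 hA).2.trans (mem_powersetCard.1 hB).2.symm)
    refine card_equiv (Equiv.mulRight τ) fun σ => ?_
    simp only [mem_filter, mem_univ, true_and, map_map, Equiv.coe_mulRight]
    rfl
  have hinv : ∀ σ : Equiv.Perm (Fin n), #{B ∈ s | p (B.map σ.toEmbedding)} = #{B ∈ s | p B} := by
    intro σ
    refine card_bij' (fun B _ => B.map σ.toEmbedding) (fun B _ => B.map σ.symm.toEmbedding)
      ?_ ?_ ?_ ?_
    · intro B hB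
      simp only [hs, mem_filter, mem_powersetCard, subset_univ, true_and, card_map] at hB ⊢
      exact hB
    · intro B hB
      have e : (B.map σ.symm.toEmbedding).map σ.toEmbedding = B := by ext x; simp
      simp only [hs, mem_filter, mem_powersetCard, subset_univ, true_and, card_map, e] at hB ⊢
      exact hB
    · intro B _
      ext x; simp
    · intro B _
      ext x; simp
  have hdc := sum_card_bipartiteAbove_eq_sum_card_bipartiteBelow
    (fun (B : Finset (Fin n)) (σ : Equiv.Perm (Fin n)) => p (B.map σ.toEmbedding))
    (s := s) (t := univ)
  simp only [bipartiteAbove, bipartiteBelow] at hdc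
  rw [sum_congr rfl hconst, sum_congr rfl fun σ _ => hinv σ, sum_const, sum_const, smul_eq_mul,
    smul_eq_mul] at hdc
  have hdc' : (#s : ℝ) * #{σ : Equiv.Perm (Fin n) | p (A.map σ.toEmbedding)} =
      #(univ : Finset (Equiv.Perm (Fin n))) * #{B ∈ s | p B} := by exact_mod_cast hdc
  have hspos : (0 : ℝ) < #s := by exact_mod_cast card_pos.2 ⟨A, hA⟩
  rw [← hscard] at hp
  apply le_of_mul_le_mul_left _ hspos
  rw [hdc']
  calc (#s : ℝ) * (q * #(univ : Finset (Equiv.Perm (Fin n))))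
      = #(univ : Finset (Equiv.Perm (Fin n))) * (q * #s) := by ring
    _ ≤ _ := mul_le_mul_of_nonneg_left hp (by positivity)

open Classical in
/-- `n + 1` permuted copies of a family handling half of the halving sets form a Galvin family. -/
theorem exists_galvin_of_half {n d : ℕ} (F : Finset (Finset (Fin n)))
    (hF : F ⊆ powersetCard (n / d) univ)
    (hhalf : (n.choose (n / 2) : ℝ) / 2 ≤
      #{A ∈ powersetCard (n / 2) (univ : Finset (Fin n)) | IsHandledBy d F A}) :
    ∃ F' : Finset (Finset (Fin n)), IsGalvinFamily d F' ∧ #F' ≤ (n + 1) * #F := by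
  obtain ⟨G, -, hGK, hG⟩ := exists_greedy_cover
    (powersetCard (n / 2) (univ : Finset (Fin n))) (univ : Finset (Equiv.Perm (Fin n)))
    (fun A σ => IsHandledBy d F (A.map σ.toEmbedding)) (q := 1 / 2) (by norm_num) univ_nonempty
    (fun A hA => by
      convert le_card_filter_perm (q := 1 / 2) (fun A => IsHandledBy d F A)
        (by rw [one_div_mul_eq_div]; exact hhalf) hA) (n + 1)
  have hzero : #{A ∈ powersetCard (n / 2) (univ : Finset (Fin n)) |
      ∀ σ ∈ G, ¬ IsHandledBy d F (A.map σ.toEmbedding)} = 0 := by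
    -- There are at most `2 ^ n` halving sets, so `n + 1` halvings leave fewer than one uncovered.
    have hlt : (1 - 1 / 2 : ℝ) ^ (n + 1) * #(powersetCard (n / 2) (univ : Finset (Fin n))) < 1 := by
      rw [card_powersetCard, card_univ, Fintype.card_fin]
      have h1 : (n.choose (n / 2) : ℝ) ≤ 2 ^ n := by exact_mod_cast Nat.choose_le_two_pow n (n / 2)
      calc _ ≤ (1 - 1 / 2 : ℝ) ^ (n + 1) * 2 ^ n := by gcongr
        _ = (1 / 2 * 2) ^ n * (1 / 2) := by rw [mul_pow]; ring
        _ < 1 := by norm_num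
    have := lt_of_le_of_lt hG hlt
    have hcard := Nat.cast_lt_one.1 this
    convert hcard
  refine ⟨G.biUnion fun σ => F.image fun S => S.map σ.symm.toEmbedding, ⟨?_, ?_⟩, ?_⟩
  · intro S hS
    obtain ⟨σ, -, hS⟩ := mem_biUnion.1 hS
    obtain ⟨T, hT, rfl⟩ := mem_image.1 hS
    exact mem_powersetCard.2 ⟨subset_univ _, by
      rw [card_map]; exact (mem_powersetCard.1 (hF hT)).2⟩
  · intro A hA
    rw [card_eq_zero, filter_eq_empty_iff] at hzero
    have := hzero hA
    push Not at this
    obtain ⟨σ, hσ, h⟩ := this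
    exact (h.image_symm σ).mono
      (subset_biUnion_of_mem (fun σ => F.image fun S => S.map σ.symm.toEmbedding) hσ)
  · exact (card_biUnion_le_card_mul _ _ #F fun σ _ => card_image_le).trans
      (Nat.mul_le_mul_right _ hGK)

/-! ### Choice of parameters, size bound and padding -/

/-- A `d`-Galvin family of size at most `2 ^ 51 * f * (log f) ^ 2`, where `f = n ^ 2 * d ^ 9`. -/
theorem exists_galvin_card_le {d n : ℕ} (hn0 : 0 < n) (hdn : 2 * d ∣ n) :
    ∃ F : Finset (Finset (Fin n)), IsGalvinFamily d F ∧
      (#F : ℝ) ≤ 2 ^ 51 * ((n : ℝ) ^ 2 * (d : ℝ) ^ 9) *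
        Real.log ((n : ℝ) ^ 2 * (d : ℝ) ^ 9) ^ 2 := by
  obtain ⟨h, hn⟩ := hdn
  have hd : 0 < d := Nat.pos_of_ne_zero fun h0 => by subst h0; omega
  have hh : 0 < h := Nat.pos_of_ne_zero fun h0 => by subst h0; omega
  have hd1 : (1 : ℝ) ≤ d := by exact_mod_cast hd
  have hh1 : (1 : ℝ) ≤ h := by exact_mod_cast hh
  have hnR : (n : ℝ) = 2 * d * h := by exact_mod_cast hn
  have hn2 : (2 : ℝ) ≤ n := by rw [hnR]; nlinarith
  set f : ℝ := (n : ℝ) ^ 2 * (d : ℝ) ^ 9 with hf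
  have hd2 : (1 : ℝ) ≤ (d : ℝ) ^ 2 := one_le_pow₀ hd1
  have hd3 : (1 : ℝ) ≤ (d : ℝ) ^ 3 := one_le_pow₀ hd1
  have hd9 : (d : ℝ) ^ 2 ≤ (d : ℝ) ^ 9 := pow_le_pow_right₀ hd1 (by norm_num)
  have hf4 : 4 ≤ f := by rw [hf]; nlinarith
  have hℓ : 1 ≤ Real.log f := by
    rw [Real.le_log_iff_exp_le (by linarith)]
    linarith [Real.exp_one_lt_d9]
  set ℓ := Real.log f with hℓdef
  have hs1 : 1 ≤ Real.sqrt h := Real.one_le_sqrt.2 hh1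
  have hss : Real.sqrt h ^ 2 = h := Real.sq_sqrt (by linarith)
  set D : ℝ := 16 * (d : ℝ) ^ 2 * (h + 1) with hD
  have hDpos : 0 < D := by positivity
  have hlogD : Real.log D ≤ 3 * ℓ := by
    have hDf : D ≤ f ^ 3 := by
      have hhn : (h : ℝ) + 1 ≤ (n : ℝ) ^ 2 := by
        have : (h : ℝ) ≤ n := by rw [hnR]; nlinarith
        nlinarith
      have h1 : (d : ℝ) ^ 2 * (h + 1) ≤ f := by
        rw [hf, mul_comm]
        exact mul_le_mul hhn hd9 (by positivity) (by positivity)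
      have h2 : 16 ≤ f ^ 2 := by nlinarith
      calc D = 16 * ((d : ℝ) ^ 2 * (h + 1)) := by rw [hD]; ring
        _ ≤ f ^ 2 * f := mul_le_mul h2 h1 (by positivity) (by positivity)
        _ = f ^ 3 := by ring
    calc Real.log D ≤ Real.log (f ^ 3) := Real.log_le_log hDpos hDf
      _ = 3 * ℓ := by rw [Real.log_pow, hℓdef]; norm_num
  -- `K` is `log D / hitProb d h` rounded up, so that `(1 - hitProb d h) ^ K ≤ exp (-log D) = 1 /
  -- D`.
  set K := ⌈2 ^ 20 * (d : ℝ) ^ 3 * Real.sqrt h * Real.log D⌉₊ with hKdef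
  set L : ℝ := (d : ℝ) ^ 3 * Real.sqrt h * ℓ with hL
  have hds : 1 ≤ (d : ℝ) ^ 3 * Real.sqrt h := by nlinarith
  have hL1 : 1 ≤ L := by rw [hL]; nlinarith
  have hKle : (K : ℝ) ≤ 2 ^ 22 * L := by
    have h1 : 2 ^ 20 * (d : ℝ) ^ 3 * Real.sqrt h * Real.log D ≤ 2 ^ 20 * 3 * L := by
      calc _ = 2 ^ 20 * ((d : ℝ) ^ 3 * Real.sqrt h) * Real.log D := by ring
        _ ≤ 2 ^ 20 * ((d : ℝ) ^ 3 * Real.sqrt h) * (3 * ℓ) :=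
          mul_le_mul_of_nonneg_left hlogD (by positivity)
        _ = _ := by rw [hL]; ring
    have h2 : (K : ℝ) ≤ 2 ^ 20 * 3 * L + 1 := by
      refine (Nat.cast_le.2 (Nat.ceil_mono h1)).trans ?_
      exact (Nat.ceil_lt_add_one (by positivity)).le
    linarith
  have hK : (1 - hitProb d h) ^ K * (16 * (d : ℝ) ^ 2 * (h + 1)) ≤ 1 := by
    have h1 : (1 - hitProb d h) ^ K ≤ Real.exp (-Real.log D) := by
      calc (1 - hitProb d h) ^ K ≤ Real.exp (-hitProb d h) ^ K :=
            pow_le_pow_left₀ (by linarith [hitProb_le_one hd hh])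
              (Real.one_sub_le_exp_neg _) K
        _ = Real.exp (-(K * hitProb d h)) := by rw [← Real.exp_nat_mul]; congr 1; ring
        _ ≤ _ := by
          apply Real.exp_le_exp.2
          apply neg_le_neg
          have := Nat.le_ceil (2 ^ 20 * (d : ℝ) ^ 3 * Real.sqrt h * Real.log D)
          unfold hitProb
          rw [mul_one_div, le_div_iff₀ (by positivity)]
          linarith
    rw [Real.exp_neg, Real.exp_log hDpos] at h1
    calc _ ≤ D⁻¹ * D := mul_le_mul_of_nonneg_right h1 hDpos.le
      _ = 1 := inv_mul_cancel₀ hDpos.ne'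
  obtain ⟨F₀, hF₀, hF₀c, hhalf⟩ := exists_family_handling_half hd hh hn hK
  obtain ⟨F, hF, hFc⟩ := exists_galvin_of_half F₀ hF₀ hhalf
  refine ⟨F, hF, ?_⟩
  have e1 : (#F₀ : ℝ) ≤ (2 * d + 8 * d ^ 2 * K) ^ 2 := by exact_mod_cast hF₀c
  have e2 : (#F : ℝ) ≤ (n + 1) * #F₀ := by exact_mod_cast hFc
  have e3 : (2 * d + 8 * d ^ 2 * K : ℝ) ≤ 9 * d ^ 2 * (2 ^ 22 * L) := by
    have h1 : (d : ℝ) ^ 2 * K ≤ d ^ 2 * (2 ^ 22 * L) :=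
      mul_le_mul_of_nonneg_left hKle (by positivity)
    have h2 : (d : ℝ) ≤ d ^ 2 := by nlinarith
    have h3 : (d : ℝ) ^ 2 * 1 ≤ d ^ 2 * L := mul_le_mul_of_nonneg_left hL1 (by positivity)
    nlinarith
  calc (#F : ℝ) ≤ (n + 1) * (9 * d ^ 2 * (2 ^ 22 * L)) ^ 2 := by
        refine e2.trans (mul_le_mul_of_nonneg_left (e1.trans ?_) (by positivity))
        exact pow_le_pow_left₀ (by positivity) e3 2
    _ ≤ (2 * n) * (9 * d ^ 2 * (2 ^ 22 * L)) ^ 2 :=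
        mul_le_mul_of_nonneg_right (by linarith) (by positivity)
    -- Of `d ^ 10 * h`, one factor `d * h` is set aside to become `n / 2`, which leaves `d ^ 9`.
    _ = 81 * 2 ^ 44 * (n * (2 * d * h) * (d : ℝ) ^ 9) * ℓ ^ 2 := by
        rw [hL]
        linear_combination (2 * n * 81 * 2 ^ 44 * (d : ℝ) ^ 10 * ℓ ^ 2) * hss
    _ = 81 * 2 ^ 44 * (f * ℓ ^ 2) := by rw [← hnR, hf]; ring
    _ ≤ 2 ^ 51 * (f * ℓ ^ 2) := mul_le_mul_of_nonneg_right (by norm_num) (by positivity)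
    _ = _ := by ring

theorem IsGalvinFamily.mono {n d : ℕ} {F F' : Finset (Finset (Fin n))} (hF : IsGalvinFamily d F)
    (hFF' : F ⊆ F') (hF' : F' ⊆ powersetCard (n / d) univ) : IsGalvinFamily d F' :=
  ⟨hF', fun A hA => (hF.2 A hA).mono hFF'⟩

theorem theorem1 :
    ∃ c₁ c₂ : ℤ, ∀ d n : ℕ, 0 < n → 2 * d ∣ n →
      ∃ F : Finset (Finset (Fin n)), IsGalvinFamily d F ∧
        min (((n : ℝ) ^ 2 * (d : ℝ) ^ 9) * Real.log ((n : ℝ) ^ 2 * (d : ℝ) ^ 9) ^ c₁)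
            (n.choose (n / d) : ℝ) ≤ (F.card : ℝ) ∧
        (F.card : ℝ) ≤
          ((n : ℝ) ^ 2 * (d : ℝ) ^ 9) * Real.log ((n : ℝ) ^ 2 * (d : ℝ) ^ 9) ^ c₂ := by
  -- Padding reaches the capped `f` itself, so `c₁ = 0`. As `f ≥ 4`, `log f ≥ 1.38` and `1.38 ^ 3 ≥
  -- 2`; hence `2 ^ 51 ≤ (log f) ^ 153`, and the two logarithms already present give `155`.
  refine ⟨0, 155, fun d n hn0 hdn => ?_⟩
  obtain ⟨F, hF, hFc⟩ := exists_galvin_card_le hn0 hdn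
  have hd : 0 < d := Nat.pos_of_ne_zero fun h0 => by
    subst h0; rw [mul_zero, zero_dvd_iff] at hdn; omega
  have hn2 : 2 ≤ n := (by omega : 2 ≤ 2 * d).trans (Nat.le_of_dvd hn0 hdn)
  have hf4 : (4 : ℝ) ≤ (n : ℝ) ^ 2 * (d : ℝ) ^ 9 := by
    have h1 : (2 : ℝ) ≤ n := by exact_mod_cast hn2
    have h2 : (1 : ℝ) ≤ (d : ℝ) ^ 9 := one_le_pow₀ (by exact_mod_cast hd)
    nlinarith
  have hcast : ((n ^ 2 * d ^ 9 : ℕ) : ℝ) = (n : ℝ) ^ 2 * (d : ℝ) ^ 9 := by push_cast; ring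
  have hFcard : #F ≤ n.choose (n / d) := by
    simpa using card_le_card hF.1
  -- Arbitrary further `(n / d)`-sets are added until the capped lower bound is met.
  obtain ⟨F', hFF', hF', hcard⟩ := exists_subsuperset_card_eq hF.1
    (n := max #F (min (n ^ 2 * d ^ 9) (n.choose (n / d)))) (le_max_left _ _)
    (by simpa using hFcard)
  refine ⟨F', hF.mono hFF' hF', ?_, ?_⟩
  · rw [zpow_zero, mul_one, hcard, ← hcast]
    exact_mod_cast le_max_right _ _
  · rw [hcard]
    have hcard' : ((max #F (min (n ^ 2 * d ^ 9) (n.choose (n / d))) : ℕ) : ℝ) ≤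
        max (#F : ℝ) ((n : ℝ) ^ 2 * (d : ℝ) ^ 9) := by
      rw [← hcast]
      exact_mod_cast max_le_max le_rfl (min_le_left _ _)
    refine hcard'.trans ?_
    set f := (n : ℝ) ^ 2 * (d : ℝ) ^ 9
    have hℓ : 1.38 ≤ Real.log f := by
      have h1 : Real.log 4 ≤ Real.log f := Real.log_le_log (by norm_num) hf4
      have h2 : Real.log 4 = 2 * Real.log 2 := by
        rw [show (4 : ℝ) = 2 ^ 2 by norm_num, Real.log_pow]; norm_num
      linarith [Real.log_two_gt_d9]
    rw [show (155 : ℤ) = ((155 : ℕ) : ℤ) by norm_num, zpow_natCast]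
    have hpow : (2 : ℝ) ^ 51 ≤ Real.log f ^ 153 := by
      rw [show 153 = 3 * 51 by norm_num, pow_mul]
      apply pow_le_pow_left₀ (by norm_num)
      calc (2 : ℝ) ≤ 1.38 ^ 3 := by norm_num
        _ ≤ _ := pow_le_pow_left₀ (by norm_num) hℓ 3
    apply max_le
    · calc (#F : ℝ) ≤ 2 ^ 51 * f * Real.log f ^ 2 := hFc
        _ = 2 ^ 51 * (f * Real.log f ^ 2) := by ring
        _ ≤ Real.log f ^ 153 * (f * Real.log f ^ 2) :=
          mul_le_mul_of_nonneg_right hpow (by positivity)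
        _ = f * Real.log f ^ 155 := by ring
    · exact le_mul_of_one_le_right (by linarith) (one_le_pow₀ (by linarith))
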